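/- Let $H_M, H_A, H_B$ be finite dimensional complex Hilbert spaces and let $\Phi_A:\mathbb{B}(H_M)\to\mathbb{B}(H_A)$ and $\Phi_B:\mathbb{B}(H_M)\to\mathbb{B}(H_B)$ be quantum channels, i.e. completely positive trace preserving linear maps. Then for every finite dimensional Hilbert space $H_C$ and every state $\rho=\rho_{MC}$ on $H_M\otimes H_C$ (a positive operator of trace one), $$H(A|C)_{(\Phi_A\otimes\mathrm{id}_C)(\rho)}+H(B|C)_{(\Phi_B\otimes\mathrm{id}_C)(\rho)}\ \ge\ H(M|C)_\rho+\log\frac1c .$$ Here $H(X|C)_\omega=H(\omega_{XC})-H(\omega_C)$ is the conditional entropy of a state $\omega$ on $H_X\otimes H_C$, where $\omega_C=(\mathrm{tr}_X\otimes\mathrm{id}_C)(\omega)$ and $H(\sigma)=-\mathrm{tr}(\sigma\log\sigma)$ is the von Neumann entropy. The constant $c$, which satisfies $0<c<\infty$ and does not depend on $H_C$ or $\rho$, is the completely bounded norm $$c=\big\|\Phi_B\circ\Phi_A^\dagger:S_1(H_A)\to\mathbb{B}(H_B)\big\|_{cb} =\sup_{n\ge 1}\ \sup\Big\{\big\|(\Phi_B\circ\Phi_A^\dagger\otimes\mathrm{id}_{\mathbb{M}_n})(x)\big\|_{\mathbb{B}(H_B\otimes\mathbb{C}^n)}\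 :\ \|x\|_{\mathbb{M}_n(S_1(H_A))}\le 1\Big\},$$ where $\Phi_A^\dagger$ is the adjoint of $\Phi_A$ for the trace inner product $\langle X,Y\rangle=\mathrm{tr}(X^*Y)$, and the operator space structure of the trace class $S_1(H_A)$ is given, for $x\in\mathbb{M}_n(S_1(H_A))\cong\mathbb{B}(H_A\otimes\mathbb{C}^n)$, by $$\|x\|_{\mathbb{M}_n(S_1(H_A))}=\sup\big\{\mathrm{tr}\,\big|(1\otimes u)\,x\,(1\otimes v)\big|\ :\ u,v\in\mathbb{M}_n,\ \mathrm{tr}(u^*u)=\mathrm{tr}(v^*v)=1\big\}.$$ -/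

import Mathlib

open Matrix
open scoped Kronecker ENNReal ComplexOrder

namespace ChannelUncertainty

/-- The ampliation `Φ ⊗ id` of a linear map `Φ : 𝔹(H_m) → 𝔹(H_a)` by the identity of `𝔹(H_k)`.
An operator on `H_m ⊗ H_k` is a matrix indexed by `m × k`; for fixed `p q : k` its `(p, q)` block
is the matrix `i, j ↦ X (i, p) (j, q)`, and `Φ ⊗ id` applies `Φ` to every block. -/
def ampliation {m a : Type*} (k : Type*) (Φ : Matrix m m ℂ →ₗ[ℂ] Matrix a a ℂ)
    (X : Matrix (m × k) (m × k) ℂ) : Matrix (a × k) (a × k) ℂ :=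
  Matrix.of fun s t => Φ (Matrix.of fun i j => X (i, s.2) (j, t.2)) s.1 t.1

/-- Completely positive maps: `Φ ⊗ id_{𝕄_n}` is positive for all `n`. -/
def IsCompletelyPositive {m a : Type*} (Φ : Matrix m m ℂ →ₗ[ℂ] Matrix a a ℂ) : Prop :=
  ∀ (n : ℕ) (X : Matrix (m × Fin n) (m × Fin n) ℂ),
    X.PosSemidef → (ampliation (Fin n) Φ X).PosSemidef

/-- Quantum channels: completely positive trace preserving maps. -/
structure IsQuantumChannel {m a : Type*} [Fintype m] [Fintype a]
    (Φ : Matrix m m ℂ →ₗ[ℂ] Matrix a a ℂ) : Prop where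
  completelyPositive : IsCompletelyPositive Φ
  trace_map : ∀ X : Matrix m m ℂ, (Φ X).trace = X.trace

/-- Density operators (states): positive semidefinite of trace one. -/
structure IsDensityOperator {m : Type*} [Fintype m] (ρ : Matrix m m ℂ) : Prop where
  posSemidef : ρ.PosSemidef
  trace_eq_one : ρ.trace = 1

/-- The adjoint `Φ†` with respect to the trace inner product `⟨X, Y⟩ = tr (X* Y)`, given by its
matrix entries `⟨e_ij, Φ† Y⟩ = ⟨Φ e_ij, Y⟩`. See `trace_traceAdjoint`. -/
def traceAdjoint {m a : Type*} [Fintype a] [DecidableEq m]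
    (Φ : Matrix m m ℂ →ₗ[ℂ] Matrix a a ℂ) : Matrix a a ℂ →ₗ[ℂ] Matrix m m ℂ where
  toFun Y := Matrix.of fun i j => ((Φ (Matrix.single i j 1))ᴴ * Y).trace
  map_add' Y Z := by
    ext i j
    simp [Matrix.mul_add]
  map_smul' c Y := by
    ext i j
    simp

/-- The defining property of the adjoint map. -/
theorem trace_traceAdjoint {m a : Type*} [Fintype m] [Fintype a] [DecidableEq m]
    (Φ : Matrix m m ℂ →ₗ[ℂ] Matrix a a ℂ) (X : Matrix m m ℂ) (Y : Matrix a a ℂ) :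
    (Xᴴ * traceAdjoint Φ Y).trace = ((Φ X)ᴴ * Y).trace := by
  have h : Φ X = ∑ i, ∑ j, X i j • Φ (Matrix.single i j 1) := by
    conv_lhs => rw [Matrix.matrix_eq_sum_single X]
    simp only [map_sum]
    refine Finset.sum_congr rfl fun i _ => Finset.sum_congr rfl fun j _ => ?_
    rw [← map_smul, Matrix.smul_single, smul_eq_mul, mul_one]
  rw [h]
  simp only [Matrix.conjTranspose_sum, Matrix.conjTranspose_smul, Matrix.sum_mul,
    Matrix.trace_sum, Matrix.smul_mul, Matrix.trace_smul]
  rw [Finset.sum_comm]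
  simp [Matrix.trace, Matrix.mul_apply, traceAdjoint]

/-- The partial trace `tr_m ⊗ id_c` on operators on `H_m ⊗ H_c`. -/
def partialTraceLeft {m c : Type*} [Fintype m] (X : Matrix (m × c) (m × c) ℂ) : Matrix c c ℂ :=
  Matrix.of fun p q => ∑ i, X (i, p) (i, q)

/-- The von Neumann entropy `H(ρ) = - tr (ρ log ρ)` (natural logarithm, `0 log 0 = 0`). -/
noncomputable def vonNeumannEntropy {m : Type*} [Fintype m] [DecidableEq m]
    (ρ : Matrix m m ℂ) : ℝ :=
  -((ρ * cfc Real.log ρ).trace).re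

/-- The conditional entropy `H(M|C)_ρ = H(ρ_MC) - H(ρ_C)`. -/
noncomputable def condEntropy {m c : Type*} [Fintype m] [DecidableEq m] [Fintype c]
    [DecidableEq c] (ρ : Matrix (m × c) (m × c) ℂ) : ℝ :=
  vonNeumannEntropy ρ - vonNeumannEntropy (partialTraceLeft ρ)

/-- The trace norm `‖X‖₁ = tr |X|`, with `|X| = (X* X)^{1/2}`. -/
noncomputable def traceNorm {m : Type*} [Fintype m] [DecidableEq m] (X : Matrix m m ℂ) : ℝ :=
  ((cfc Real.sqrt (Xᴴ * X)).trace).re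

/-- The Hilbert-Schmidt norm `‖X‖₂ = (tr (X* X))^{1/2}`. -/
noncomputable def hilbertSchmidtNorm {m : Type*} [Fintype m] (X : Matrix m m ℂ) : ℝ :=
  Real.sqrt ((Xᴴ * X).trace).re

/-- The operator norm on `𝔹(H_m)` (Euclidean norm on `H_m = ℂ^m`). -/
noncomputable def operatorNorm {m : Type*} [Fintype m] [DecidableEq m] (X : Matrix m m ℂ) : ℝ :=
  ‖Matrix.toEuclideanCLM (n := m) (𝕜 := ℂ) X‖

/-- The matrix norms of the operator space `S₁(H_a)`: the norm of `𝕄_n(S₁(H_a)) =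
S_∞(ℂⁿ, S₁(H_a)) = L_∞^1(𝔹(ℂⁿ) ⊆ 𝔹(H_a ⊗ ℂⁿ))`, that is the supremum of
`‖(1 ⊗ u) X (1 ⊗ v)‖₁` over `u, v ∈ 𝕄_n` of Hilbert-Schmidt norm one. -/
noncomputable def matrixNormS1 {a : Type*} [Fintype a] [DecidableEq a] (n : ℕ)
    (X : Matrix (a × Fin n) (a × Fin n) ℂ) : ℝ≥0∞ :=
  ⨆ (u : Matrix (Fin n) (Fin n) ℂ) (v : Matrix (Fin n) (Fin n) ℂ)
    (_ : hilbertSchmidtNorm u = 1) (_ : hilbertSchmidtNorm v = 1),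
    ENNReal.ofReal (traceNorm
      (((1 : Matrix a a ℂ) ⊗ₖ u) * X * ((1 : Matrix a a ℂ) ⊗ₖ v)))

/-- The completely bounded norm `‖T : S₁(H_a) → 𝔹(H_b)‖_cb`: the supremum over `n` of the norm of
`T ⊗ id : 𝕄_n(S₁(H_a)) → 𝕄_n(𝔹(H_b)) = 𝔹(H_b ⊗ ℂⁿ)`. -/
noncomputable def cbNorm {a b : Type*} [Fintype a] [DecidableEq a] [Fintype b] [DecidableEq b]
    (T : Matrix a a ℂ →ₗ[ℂ] Matrix b b ℂ) : ℝ≥0∞ :=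
  ⨆ (n : ℕ) (X : Matrix (a × Fin n) (a × Fin n) ℂ) (_ : matrixNormS1 n X ≤ 1),
    ENNReal.ofReal (operatorNorm (ampliation (Fin n) T X))

end ChannelUncertainty

/-!
Let `V` be the Stinespring isometry of `ΦA`, so that `ΦA ρ = tr_S (V ρ Vᴴ)`, and let `ω = ΦA ρ + ε`,
where the channels are understood to be tensored with the identity on `C`. Monotonicity of the
relative entropy under `X ↦ ΦB (Vᴴ X V)`, applied to the pair `V ρ Vᴴ`, `ω ⊗ 1`, gives
`D(ΦB ρ ‖ τ) ≤ -H(ρ) - tr (ΦA ρ log ω)` for every `τ ≥ ΦB ΦA† ω`. The maximally entangled vector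
has norm at most one in the matrix norms of the trace class, hence the Choi matrix of
`T = ΦB ΦA†` is at most `c = ‖T‖_cb`. Thus `Y ↦ c tr(Y) 1 - T Y` is completely positive,
so that `τ = c 1 ⊗ ω_C` is admissible, and `ε → 0` yields the inequality.

For monotonicity, write `-log` as an integral of resolvents of the relative modular operator `Δ`.
The quantity `⟨√ρ, (Δ + t)⁻¹ √ρ⟩` is the maximum over `X` of a quadratic form, and Kraus maps
decrease these maxima by the operator Schwarz inequality.
-/

namespace ChannelUncertainty

section KrausMaps

variable {m a b S R : Type*} [Fintype m] [Fintype S]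

/-- The completely positive map `X ↦ ∑ s, K s * X * (K s)ᴴ` with Kraus operators `K`. -/
def krausMap (K : S → Matrix a m ℂ) : Matrix m m ℂ →ₗ[ℂ] Matrix a a ℂ where
  toFun X := ∑ s, K s * X * (K s)ᴴ
  map_add' X Y := by simp only [Matrix.mul_add, Matrix.add_mul, Finset.sum_add_distrib]
  map_smul' c X := by
    simp only [Matrix.mul_smul, Matrix.smul_mul, Finset.smul_sum, RingHom.id_apply]

theorem krausMap_apply (K : S → Matrix a m ℂ) (X : Matrix m m ℂ) :
    krausMap K X = ∑ s, K s * X * (K s)ᴴ := rfl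

theorem conjTranspose_krausMap (K : S → Matrix a m ℂ) (X : Matrix m m ℂ) :
    (krausMap K X)ᴴ = krausMap K Xᴴ := by
  simp only [krausMap_apply, conjTranspose_sum, conjTranspose_mul, conjTranspose_conjTranspose,
    Matrix.mul_assoc]

theorem posSemidef_krausMap [Finite a] (K : S → Matrix a m ℂ) {X : Matrix m m ℂ}
    (hX : X.PosSemidef) : (krausMap K X).PosSemidef :=
  posSemidef_sum _ fun s _ => hX.mul_mul_conjTranspose_same (K s)

theorem trace_krausMap_mul [Fintype a] (K : S → Matrix a m ℂ) (X : Matrix m m ℂ)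
    (Y : Matrix a a ℂ) :
    (krausMap K X * Y).trace = (X * krausMap (fun s => (K s)ᴴ) Y).trace := by
  simp only [krausMap_apply, Matrix.sum_mul, Matrix.mul_sum, trace_sum,
    conjTranspose_conjTranspose]
  refine Finset.sum_congr rfl fun s _ => ?_
  rw [Matrix.mul_assoc, Matrix.mul_assoc, Matrix.trace_mul_comm]
  simp only [Matrix.mul_assoc]

theorem krausMap_comp_krausMap [Fintype a] [Fintype R] (L : R → Matrix b a ℂ)
    (K : S → Matrix a m ℂ) :
    krausMap L ∘ₗ krausMap K = krausMap fun z : R × S => L z.1 * K z.2 := by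
  ext1 X
  simp only [LinearMap.comp_apply, krausMap_apply, Fintype.sum_prod_type, Matrix.mul_sum,
    Matrix.sum_mul, conjTranspose_mul, Matrix.mul_assoc]

theorem sum_conjTranspose_mul_eq_one [Fintype a] [DecidableEq m] {K : S → Matrix a m ℂ}
    (hK : ∀ X, (krausMap K X).trace = X.trace) : ∑ s, (K s)ᴴ * K s = 1 := by
  classical
  refine Matrix.ext_iff_trace_mul_left.2 fun X => ?_
  have h := trace_krausMap_mul K X 1
  simpa only [krausMap_apply, Matrix.mul_one, conjTranspose_conjTranspose, ← hK X] using h.symm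

theorem traceAdjoint_krausMap [Fintype a] [DecidableEq m] (K : S → Matrix a m ℂ) :
    traceAdjoint (krausMap K) = krausMap fun s => (K s)ᴴ := by
  ext1 Y
  refine Matrix.ext_iff_trace_mul_left.2 fun X => ?_
  have h := trace_traceAdjoint (krausMap K) Xᴴ Y
  rwa [conjTranspose_krausMap, conjTranspose_conjTranspose, trace_krausMap_mul] at h

theorem ampliation_krausMap {c : Type*} [Fintype c] [DecidableEq c] (K : S → Matrix a m ℂ)
    (X : Matrix (m × c) (m × c) ℂ) :
    ampliation c (krausMap K) X = krausMap (fun s => K s ⊗ₖ (1 : Matrix c c ℂ)) X := by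
  ext ⟨x, p⟩ ⟨y, q⟩
  simp only [ampliation, krausMap_apply, Matrix.of_apply, Matrix.sum_apply, Matrix.mul_apply,
    kroneckerMap_apply, conjTranspose_apply, Fintype.sum_prod_type, Matrix.one_apply, mul_ite,
    ite_mul, mul_one, mul_zero, zero_mul, apply_ite star, star_zero, Finset.sum_ite_eq,
    Finset.mem_univ, if_true]

theorem isCompletelyPositive_krausMap [Finite a] (K : S → Matrix a m ℂ) :
    IsCompletelyPositive (krausMap K) := fun n X hX =>
  ampliation_krausMap (c := Fin n) K X ▸ posSemidef_krausMap _ hX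

end KrausMaps

section Choi

variable {m a : Type*}

/-- The unnormalized maximally entangled vector of `H_m ⊗ ℂⁿ` given by `e : m ≃ Fin n`. -/
def maxEntVec {n : ℕ} (e : m ≃ Fin n) : m × Fin n → ℂ :=
  fun s => if e s.1 = s.2 then 1 else 0

/-- The Choi matrix of `Φ`, whose `(e i, e j)` block is `Φ (single i j 1)`. -/
def choi {n : ℕ} (e : m ≃ Fin n) (Φ : Matrix m m ℂ →ₗ[ℂ] Matrix a a ℂ) :
    Matrix (a × Fin n) (a × Fin n) ℂ :=
  ampliation (Fin n) Φ (vecMulVec (maxEntVec e) (star (maxEntVec e)))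

theorem choi_apply [DecidableEq m] {n : ℕ} (e : m ≃ Fin n)
    (Φ : Matrix m m ℂ →ₗ[ℂ] Matrix a a ℂ) (x y : a) (i j : m) :
    choi e Φ (x, e i) (y, e j) = Φ (Matrix.single i j 1) x y := by
  refine congrArg (fun Z => Φ Z x y) ?_
  ext k l
  simp only [Matrix.of_apply, vecMulVec_apply, maxEntVec, Pi.star_apply, Matrix.single_apply,
    e.injective.eq_iff]
  by_cases h1 : i = k <;> by_cases h2 : j = l <;> simp [h1, h2, eq_comm]

theorem choi_injective {n : ℕ} (e : m ≃ Fin n) [Finite m] :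
    Function.Injective (choi e : (Matrix m m ℂ →ₗ[ℂ] Matrix a a ℂ) → _) := by
  classical
  intro Φ Ψ h
  refine Matrix.ext_linearMap ℂ fun i j => LinearMap.ext_ring ?_
  ext x y
  simp only [LinearMap.comp_apply, Matrix.singleLinearMap_apply, ← choi_apply e, h]

theorem choi_krausMap_apply [Fintype m] {S : Type*} [Fintype S] {n : ℕ} (e : m ≃ Fin n)
    (K : S → Matrix a m ℂ) (x y : a) (i j : m) :
    choi e (krausMap K) (x, e i) (y, e j) = ∑ s, K s x i * star (K s y j) := by
  classical
  rw [choi_apply, krausMap_apply, Matrix.sum_apply]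
  refine Finset.sum_congr rfl fun s _ => ?_
  simp [Matrix.mul_apply, Matrix.single_apply, ite_and]

theorem exists_eq_krausMap_of_posSemidef_choi [Fintype m] [Fintype a] {n : ℕ} (e : m ≃ Fin n)
    {Φ : Matrix m m ℂ →ₗ[ℂ] Matrix a a ℂ} (h : (choi e Φ).PosSemidef) :
    ∃ K : a × Fin n → Matrix a m ℂ, Φ = krausMap K := by
  classical
  open scoped MatrixOrder in
  obtain ⟨D, hD⟩ := CStarAlgebra.nonneg_iff_eq_star_mul_self.1 h.nonneg
  refine ⟨fun s => Matrix.of fun x i => star (D s (x, e i)), choi_injective e ?_⟩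
  ext ⟨x, p⟩ ⟨y, q⟩
  obtain ⟨i, rfl⟩ := e.surjective p
  obtain ⟨j, rfl⟩ := e.surjective q
  rw [choi_krausMap_apply, hD]
  simp [Matrix.mul_apply]

theorem IsCompletelyPositive.exists_eq_krausMap [Fintype m] [Fintype a]
    {Φ : Matrix m m ℂ →ₗ[ℂ] Matrix a a ℂ} (h : IsCompletelyPositive Φ) :
    ∃ K : a × Fin (Fintype.card m) → Matrix a m ℂ, Φ = krausMap K :=
  exists_eq_krausMap_of_posSemidef_choi (Fintype.equivFin m)
    (h _ _ (posSemidef_vecMulVec_self_star _))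

end Choi

section PartialTrace

variable {m a b c : Type*}

theorem ampliation_comp (c : Type*) (Ψ : Matrix a a ℂ →ₗ[ℂ] Matrix b b ℂ)
    (Φ : Matrix m m ℂ →ₗ[ℂ] Matrix a a ℂ) (X : Matrix (m × c) (m × c) ℂ) :
    ampliation c (Ψ ∘ₗ Φ) X = ampliation c Ψ (ampliation c Φ X) := rfl

variable [Fintype m]

theorem partialTraceLeft_ampliation [Fintype a] {Φ : Matrix m m ℂ →ₗ[ℂ] Matrix a a ℂ}
    (hΦ : ∀ X, (Φ X).trace = X.trace) (X : Matrix (m × c) (m × c) ℂ) :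
    partialTraceLeft (ampliation c Φ X) = partialTraceLeft X := by
  ext p q
  exact hΦ (Matrix.of fun i j => X (i, p) (j, q))

theorem partialTraceLeft_add_smul_one [DecidableEq m] [DecidableEq c]
    (X : Matrix (m × c) (m × c) ℂ) (ε : ℝ) :
    partialTraceLeft (X + ε • 1) = partialTraceLeft X + (Fintype.card m * ε) • 1 := by
  ext p q
  by_cases hpq : p = q <;>
    simp [partialTraceLeft, Finset.sum_add_distrib, Matrix.one_apply, hpq]

theorem posSemidef_partialTraceLeft {X : Matrix (m × c) (m × c) ℂ} (hX : X.PosSemidef) :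
    (partialTraceLeft X).PosSemidef := by
  have h : partialTraceLeft X = ∑ i, X.submatrix (fun p => (i, p)) (fun p => (i, p)) := by
    ext p q
    simp only [partialTraceLeft, Matrix.of_apply, Matrix.sum_apply, submatrix_apply]
  rw [h]
  exact posSemidef_sum _ fun i _ => hX.submatrix _

variable [Fintype c]

theorem trace_partialTraceLeft (X : Matrix (m × c) (m × c) ℂ) :
    (partialTraceLeft X).trace = X.trace := by
  simp only [partialTraceLeft, Matrix.trace, Matrix.diag_apply, Matrix.of_apply,
    Fintype.sum_prod_type]
  exact Finset.sum_comm

theorem trace_ampliation [Fintype a] {Φ : Matrix m m ℂ →ₗ[ℂ] Matrix a a ℂ}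
    (hΦ : ∀ X, (Φ X).trace = X.trace) (X : Matrix (m × c) (m × c) ℂ) :
    (ampliation c Φ X).trace = X.trace := by
  rw [← trace_partialTraceLeft, partialTraceLeft_ampliation hΦ, trace_partialTraceLeft]

theorem trace_mul_one_kronecker [DecidableEq m] (X : Matrix (m × c) (m × c) ℂ)
    (R : Matrix c c ℂ) :
    (X * ((1 : Matrix m m ℂ) ⊗ₖ R)).trace = (partialTraceLeft X * R).trace := by
  simp only [Matrix.trace, Matrix.diag_apply, Matrix.mul_apply, Fintype.sum_prod_type,
    kroneckerMap_apply, Matrix.one_apply, ite_mul, one_mul, zero_mul, mul_ite, mul_zero,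
    Finset.sum_ite_irrel, Finset.sum_const_zero, Finset.sum_ite_eq', Finset.mem_univ, if_true,
    partialTraceLeft, Matrix.of_apply, Finset.sum_mul]
  rw [Finset.sum_comm]
  exact Finset.sum_congr rfl fun p _ => Finset.sum_comm

end PartialTrace

section Stinespring

variable {m a S : Type*}

/-- The Stinespring operator `V : H_m → H_a ⊗ ℂ^S` of the Kraus family `K`. -/
def stinespring (K : S → Matrix a m ℂ) : Matrix (a × S) m ℂ :=
  Matrix.of fun x i => K x.2 x.1 i

theorem stinespring_apply (K : S → Matrix a m ℂ) (x : a) (s : S) (i : m) :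
    stinespring K (x, s) i = K s x i := rfl

variable [Fintype a] [Fintype S]

theorem conjTranspose_stinespring_mul_mul [DecidableEq S] (K : S → Matrix a m ℂ)
    (Y : Matrix a a ℂ) :
    (stinespring K)ᴴ * (Y ⊗ₖ (1 : Matrix S S ℂ)) * stinespring K
      = krausMap (fun s => (K s)ᴴ) Y := by
  ext i j
  simp only [krausMap_apply, conjTranspose_conjTranspose, Matrix.sum_apply, Matrix.mul_apply,
    conjTranspose_apply, kroneckerMap_apply, stinespring_apply, Fintype.sum_prod_type,
    Matrix.one_apply, mul_ite, mul_one, mul_zero, Finset.sum_ite_eq', Finset.mem_univ, if_true]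
  exact Finset.sum_comm

theorem conjTranspose_stinespring_mul_self (K : S → Matrix a m ℂ) :
    (stinespring K)ᴴ * stinespring K = ∑ s, (K s)ᴴ * K s := by
  classical
  simpa [krausMap_apply] using conjTranspose_stinespring_mul_mul K 1

end Stinespring

section Kronecker

variable {a b : Type*} [Fintype a] [DecidableEq a] [Fintype b] [DecidableEq b]

/-- The unital star homomorphism `X ↦ X ⊗ 1`. -/
def kroneckerOne (a b : Type*) [Fintype a] [DecidableEq a] [Fintype b] [DecidableEq b] :
    Matrix a a ℂ →⋆ₐ[ℂ] Matrix (a × b) (a × b) ℂ where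
  toFun X := X ⊗ₖ 1
  map_one' := one_kronecker_one
  map_mul' X Y := by rw [← mul_kronecker_mul, Matrix.one_mul]
  map_zero' := zero_kronecker _
  map_add' X Y := add_kronecker X Y _
  commutes' r := by
    rw [Algebra.algebraMap_eq_smul_one, Algebra.algebraMap_eq_smul_one, smul_kronecker,
      one_kronecker_one]
  map_star' X := by
    rw [star_eq_conjTranspose, star_eq_conjTranspose, conjTranspose_kronecker, conjTranspose_one]

/-- The unital star homomorphism `X ↦ 1 ⊗ X`. -/
def oneKronecker (a b : Type*) [Fintype a] [DecidableEq a] [Fintype b] [DecidableEq b] :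
    Matrix b b ℂ →⋆ₐ[ℂ] Matrix (a × b) (a × b) ℂ where
  toFun X := 1 ⊗ₖ X
  map_one' := one_kronecker_one
  map_mul' X Y := by rw [← mul_kronecker_mul, Matrix.one_mul]
  map_zero' := kronecker_zero _
  map_add' X Y := kronecker_add _ X Y
  commutes' r := by
    rw [Algebra.algebraMap_eq_smul_one, Algebra.algebraMap_eq_smul_one, kronecker_smul,
      one_kronecker_one]
  map_star' X := by
    rw [star_eq_conjTranspose, star_eq_conjTranspose, conjTranspose_kronecker, conjTranspose_one]

theorem continuousOn_spectrum (X : Matrix a a ℂ) (f : ℝ → ℝ) : ContinuousOn f (spectrum ℝ X) :=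
  X.finite_real_spectrum.continuousOn f

theorem cfc_kronecker_one (f : ℝ → ℝ) {X : Matrix a a ℂ} (hX : X.IsHermitian) :
    cfc f (X ⊗ₖ (1 : Matrix b b ℂ)) = cfc f X ⊗ₖ 1 :=
  ((kroneckerOne a b).map_cfc f X (continuousOn_spectrum X f)
    (LinearMap.continuous_of_finiteDimensional (kroneckerOne a b).toAlgHom.toLinearMap)
    hX (hX.isSelfAdjoint.map (kroneckerOne a b))).symm

theorem cfc_one_kronecker (f : ℝ → ℝ) {X : Matrix b b ℂ} (hX : X.IsHermitian) :
    cfc f ((1 : Matrix a a ℂ) ⊗ₖ X) = 1 ⊗ₖ cfc f X :=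
  ((oneKronecker a b).map_cfc f X (continuousOn_spectrum X f)
    (LinearMap.continuous_of_finiteDimensional (oneKronecker a b).toAlgHom.toLinearMap)
    hX (hX.isSelfAdjoint.map (oneKronecker a b))).symm

end Kronecker

section Spectral

variable {m : Type*} [Fintype m] [DecidableEq m] {ρ σ : Matrix m m ℂ}

theorem cfc_eq_eigenvectorUnitary_mul_diagonal (hρ : ρ.IsHermitian) (f : ℝ → ℝ) :
    cfc f ρ = (hρ.eigenvectorUnitary : Matrix m m ℂ)
      * diagonal (fun i => (f (hρ.eigenvalues i) : ℂ))
      * (hρ.eigenvectorUnitary : Matrix m m ℂ)ᴴ := by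
  rw [hρ.cfc_eq]
  rfl

theorem re_trace_cfc (hρ : ρ.IsHermitian) (f : ℝ → ℝ) :
    (cfc f ρ).trace.re = ∑ i, f (hρ.eigenvalues i) := by
  have hU : (hρ.eigenvectorUnitary : Matrix m m ℂ)ᴴ * hρ.eigenvectorUnitary = 1 :=
    Unitary.coe_star_mul_self _
  rw [cfc_eq_eigenvectorUnitary_mul_diagonal hρ, Matrix.trace_mul_comm, ← Matrix.mul_assoc, hU,
    Matrix.one_mul, trace_diagonal, Complex.re_sum]
  simp only [Complex.ofReal_re]

theorem cfc_one_fun (hρ : ρ.IsHermitian) : cfc (fun _ : ℝ => (1 : ℝ)) ρ = 1 :=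
  cfc_const_one ℝ ρ hρ

theorem mul_cfc (hρ : ρ.IsHermitian) (f : ℝ → ℝ) : ρ * cfc f ρ = cfc (fun x => x * f x) ρ := by
  conv_lhs => enter [1]; rw [← cfc_id' ℝ ρ hρ]
  exact (cfc_mul _ f ρ (continuousOn_spectrum ρ _) (continuousOn_spectrum ρ f)).symm

/-- The matrix of `X` relative to an eigenbasis of `ρ` in the source and one of `σ` in the
target. -/
noncomputable def eigenCoord (hρ : ρ.IsHermitian) (hσ : σ.IsHermitian) (X : Matrix m m ℂ) :
    Matrix m m ℂ :=
  (hσ.eigenvectorUnitary : Matrix m m ℂ)ᴴ * X * hρ.eigenvectorUnitary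

theorem eigenCoord_surjective (hρ : ρ.IsHermitian) (hσ : σ.IsHermitian) :
    Function.Surjective (eigenCoord hρ hσ) := by
  intro H
  have hU : (hρ.eigenvectorUnitary : Matrix m m ℂ)ᴴ * hρ.eigenvectorUnitary = 1 :=
    Unitary.coe_star_mul_self _
  have hV : (hσ.eigenvectorUnitary : Matrix m m ℂ)ᴴ * hσ.eigenvectorUnitary = 1 :=
    Unitary.coe_star_mul_self _
  refine ⟨hσ.eigenvectorUnitary * H * (hρ.eigenvectorUnitary : Matrix m m ℂ)ᴴ, ?_⟩
  rw [eigenCoord, Matrix.mul_assoc _ H, ← Matrix.mul_assoc, hV, Matrix.one_mul, Matrix.mul_assoc,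
    hU, Matrix.mul_one]

theorem trace_cfc_mul_mul_cfc_mul (hρ : ρ.IsHermitian) (hσ : σ.IsHermitian) (f g : ℝ → ℝ)
    (X Y : Matrix m m ℂ) :
    (cfc g σ * X * cfc f ρ * Yᴴ).trace = ∑ k, ∑ i, (g (hσ.eigenvalues k) * f (hρ.eigenvalues i) : ℝ)
      * (eigenCoord hρ hσ X k i * star (eigenCoord hρ hσ Y k i)) := by
  have h : (cfc g σ * X * cfc f ρ * Yᴴ).trace
      = (diagonal (fun k => (g (hσ.eigenvalues k) : ℂ)) * eigenCoord hρ hσ X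
        * diagonal (fun i => (f (hρ.eigenvalues i) : ℂ)) * (eigenCoord hρ hσ Y)ᴴ).trace := by
    rw [cfc_eq_eigenvectorUnitary_mul_diagonal hρ, cfc_eq_eigenvectorUnitary_mul_diagonal hσ]
    simp only [eigenCoord, Matrix.mul_assoc, conjTranspose_mul, conjTranspose_conjTranspose]
    rw [Matrix.trace_mul_comm]
    simp only [Matrix.mul_assoc]
  rw [h, Matrix.trace]
  refine Finset.sum_congr rfl fun k _ => ?_
  rw [Matrix.diag_apply, Matrix.mul_apply]
  refine Finset.sum_congr rfl fun i _ => ?_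
  rw [Matrix.mul_diagonal, Matrix.diagonal_mul, conjTranspose_apply]
  push_cast
  ring

/-- The squared overlaps `|⟨k|i⟩|²` of the eigenvectors `k` of `σ` and `i` of `ρ`. -/
noncomputable def eigenOverlap (hρ : ρ.IsHermitian) (hσ : σ.IsHermitian) (k i : m) : ℝ :=
  Complex.normSq (eigenCoord hρ hσ 1 k i)

theorem re_trace_cfc_mul_cfc (hρ : ρ.IsHermitian) (hσ : σ.IsHermitian) (f g : ℝ → ℝ) :
    (cfc f ρ * cfc g σ).trace.re = ∑ k, ∑ i,
      eigenOverlap hρ hσ k i * (f (hρ.eigenvalues i) * g (hσ.eigenvalues k)) := by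
  have h := trace_cfc_mul_mul_cfc_mul hρ hσ f g 1 1
  rw [Matrix.mul_one, conjTranspose_one, Matrix.mul_one] at h
  rw [Matrix.trace_mul_comm, h]
  simp only [Complex.star_def, Complex.mul_conj, ← Complex.ofReal_mul, Complex.re_sum,
    Complex.ofReal_re, eigenOverlap]
  exact Finset.sum_congr rfl fun k _ => Finset.sum_congr rfl fun i _ => by ring

end Spectral

section Entropy

variable {m a : Type*} [Fintype m] [DecidableEq m] [Fintype a] [DecidableEq a]
  {ρ σ : Matrix m m ℂ}

theorem vonNeumannEntropy_eq_re_trace_cfc (hρ : ρ.IsHermitian) :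
    vonNeumannEntropy ρ = (cfc Real.negMulLog ρ).trace.re := by
  rw [vonNeumannEntropy, mul_cfc hρ, ← Complex.neg_re, ← trace_neg, ← cfc_neg]
  simp only [Real.negMulLog_def, neg_mul]

/-- The non-unital star homomorphism `X ↦ V * X * Vᴴ` for an isometry `V`. -/
def isometryConj (V : Matrix a m ℂ) (hV : Vᴴ * V = 1) : Matrix m m ℂ →⋆ₙₐ[ℂ] Matrix a a ℂ where
  toFun X := V * X * Vᴴ
  map_smul' r X := by rw [Matrix.mul_smul, Matrix.smul_mul]; rfl
  map_zero' := by rw [Matrix.mul_zero, Matrix.zero_mul]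
  map_add' X Y := by rw [Matrix.mul_add, Matrix.add_mul]
  map_mul' X Y := by
    calc V * (X * Y) * Vᴴ = V * X * (Vᴴ * V) * Y * Vᴴ := by
          rw [hV, Matrix.mul_one]; simp only [Matrix.mul_assoc]
      _ = V * X * Vᴴ * (V * Y * Vᴴ) := by simp only [Matrix.mul_assoc]
  map_star' X := by
    simp only [star_eq_conjTranspose, conjTranspose_mul, conjTranspose_conjTranspose,
      Matrix.mul_assoc]

theorem vonNeumannEntropy_isometry_conj {V : Matrix a m ℂ} (hV : Vᴴ * V = 1)
    (hρ : ρ.IsHermitian) : vonNeumannEntropy (V * ρ * Vᴴ) = vonNeumannEntropy ρ := by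
  have hVρ : (V * ρ * Vᴴ).IsHermitian := isHermitian_mul_mul_conjTranspose V hρ
  have hcont : Continuous (isometryConj V hV) :=
    (continuous_const.matrix_mul continuous_id).matrix_mul continuous_const
  have h : cfcₙ Real.negMulLog (V * ρ * Vᴴ) = V * cfcₙ Real.negMulLog ρ * Vᴴ :=
    ((isometryConj V hV).map_cfcₙ Real.negMulLog ρ Real.continuous_negMulLog.continuousOn
      Real.negMulLog_zero hcont hρ hVρ).symm
  rw [vonNeumannEntropy_eq_re_trace_cfc hVρ, vonNeumannEntropy_eq_re_trace_cfc hρ,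
    ← cfcₙ_eq_cfc, ← cfcₙ_eq_cfc, h, Matrix.trace_mul_comm, ← Matrix.mul_assoc, hV,
    Matrix.one_mul]

open Filter Topology in
theorem tendsto_re_trace_mul_log_add_smul_one (hρ : ρ.IsHermitian) :
    Tendsto (fun ε : ℝ => (ρ * cfc Real.log (ρ + ε • 1)).trace.re) (𝓝 0)
      (𝓝 (-vonNeumannEntropy ρ)) := by
  have hlog (ε : ℝ) : cfc Real.log (ρ + ε • 1) = cfc (fun x => Real.log (x + ε)) ρ := by
    have hadd : ρ + ε • 1 = cfc (fun x => x + ε) ρ := by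
      rw [cfc_add_const ε (fun x => x) ρ, cfc_id' ℝ ρ, Algebra.algebraMap_eq_smul_one]
    rw [hadd, ← cfc_comp' Real.log _ ρ ((ρ.finite_real_spectrum.image _).continuousOn _)]
  simp only [hlog, mul_cfc hρ, vonNeumannEntropy, neg_neg, re_trace_cfc hρ]
  refine tendsto_finsetSum _ fun i _ => ?_
  rcases eq_or_ne (hρ.eigenvalues i) 0 with h | h
  · simp only [h, zero_mul, tendsto_const_nhds]
  · have hadd : Tendsto (fun ε => hρ.eigenvalues i + ε) (𝓝 0) (𝓝 (hρ.eigenvalues i)) := by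
      simpa using (tendsto_id (x := 𝓝 (0 : ℝ))).const_add (hρ.eigenvalues i)
    exact (hadd.log h).const_mul _

/-- The relative entropy `D(ρ‖σ) = tr ρ (log ρ - log σ)`; a meaningful value only when the support
of `σ` contains that of `ρ`, in particular for positive definite `σ`. -/
noncomputable def relEntropy (ρ σ : Matrix m m ℂ) : ℝ :=
  -vonNeumannEntropy ρ - (ρ * cfc Real.log σ).trace.re

theorem relEntropy_eq_sum (hρ : ρ.IsHermitian) (hσ : σ.IsHermitian) :
    relEntropy ρ σ = ∑ k, ∑ i, eigenOverlap hρ hσ k i * (hρ.eigenvalues i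
      * (Real.log (hρ.eigenvalues i) - Real.log (hσ.eigenvalues k))) := by
  have hρρ : -vonNeumannEntropy ρ
      = (cfc (fun x => x * Real.log x) ρ * cfc (fun _ : ℝ => (1 : ℝ)) σ).trace.re := by
    rw [cfc_one_fun hσ, Matrix.mul_one, vonNeumannEntropy, neg_neg, mul_cfc hρ]
  have hid : cfc (fun x : ℝ => x) ρ = ρ := cfc_id' ℝ ρ hρ
  have hρσ : (ρ * cfc Real.log σ).trace.re
      = (cfc (fun x : ℝ => x) ρ * cfc Real.log σ).trace.re := by rw [hid]
  rw [relEntropy, hρρ, hρσ, re_trace_cfc_mul_cfc hρ hσ, re_trace_cfc_mul_cfc hρ hσ]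
  simp only [← Finset.sum_sub_distrib]
  exact Finset.sum_congr rfl fun k _ => Finset.sum_congr rfl fun i _ => by ring

end Entropy

section ModularForm

variable {m a S : Type*} [Fintype m] [Fintype a] [Fintype S]

/-- The quadratic form in `X` whose maximum is `⟨√ρ, (Δ + t)⁻¹ √ρ⟩`, where `Δ` is the relative
modular operator `Y ↦ σ Y ρ⁻¹`. -/
def modularForm (ρ σ : Matrix m m ℂ) (t : ℝ) (X : Matrix m m ℂ) : ℝ :=
  2 * (ρ * X).trace.re - (σ * (X * Xᴴ)).trace.re - t * (ρ * (Xᴴ * X)).trace.re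

theorem re_trace_mul_nonneg {σ D : Matrix m m ℂ} (hσ : σ.PosSemidef) (hD : D.PosSemidef) :
    0 ≤ (σ * D).trace.re := by
  classical
  open scoped MatrixOrder in
  obtain ⟨Z, rfl⟩ := CStarAlgebra.nonneg_iff_eq_star_mul_self.1 hD.nonneg
  rw [star_eq_conjTranspose, ← Matrix.mul_assoc, Matrix.trace_mul_comm, ← Matrix.mul_assoc]
  exact (Complex.le_def.1 (hσ.mul_mul_conjTranspose_same Z).trace_nonneg).1

theorem re_trace_mul_le_of_posSemidef_sub {σ X Y : Matrix m m ℂ} (hσ : σ.PosSemidef)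
    (h : (Y - X).PosSemidef) : (σ * X).trace.re ≤ (σ * Y).trace.re := by
  have := re_trace_mul_nonneg hσ h
  rwa [Matrix.mul_sub, trace_sub, Complex.sub_re, sub_nonneg] at this

variable [DecidableEq m]

theorem posSemidef_krausMap_mul_conjTranspose_sub {K : S → Matrix a m ℂ}
    (hK : (1 - ∑ s, (K s)ᴴ * K s).PosSemidef) (X : Matrix a a ℂ) :
    (krausMap (fun s => (K s)ᴴ) (X * Xᴴ)
      - krausMap (fun s => (K s)ᴴ) X * (krausMap (fun s => (K s)ᴴ) X)ᴴ).PosSemidef := by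
  set F := krausMap (fun s => (K s)ᴴ) X with hF
  have h : krausMap (fun s => (K s)ᴴ) (X * Xᴴ) - F * Fᴴ
      = ∑ s, ((K s)ᴴ * X - F * (K s)ᴴ) * ((K s)ᴴ * X - F * (K s)ᴴ)ᴴ
        + F * (1 - ∑ s, (K s)ᴴ * K s) * Fᴴ := by
    have hFX : ∑ s, (K s)ᴴ * X * K s = F := by
      rw [hF, krausMap_apply]; simp only [conjTranspose_conjTranspose]
    have hFX' : ∑ s, (K s)ᴴ * Xᴴ * K s = Fᴴ := by
      rw [hF, conjTranspose_krausMap, krausMap_apply]; simp only [conjTranspose_conjTranspose]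
    have hexp (s : S) : ((K s)ᴴ * X - F * (K s)ᴴ) * ((K s)ᴴ * X - F * (K s)ᴴ)ᴴ
        = (K s)ᴴ * (X * Xᴴ) * K s - (K s)ᴴ * X * K s * Fᴴ - F * ((K s)ᴴ * Xᴴ * K s)
          + F * ((K s)ᴴ * K s) * Fᴴ := by
      simp only [conjTranspose_sub, conjTranspose_mul, conjTranspose_conjTranspose,
        Matrix.sub_mul, Matrix.mul_sub, Matrix.mul_assoc]
      abel
    simp only [hexp, Finset.sum_add_distrib, Finset.sum_sub_distrib, ← Matrix.sum_mul,
      ← Matrix.mul_sum, hFX, hFX', Matrix.mul_sub, Matrix.sub_mul, Matrix.mul_one, krausMap_apply,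
      conjTranspose_conjTranspose]
    abel
  rw [h]
  exact (posSemidef_sum _ fun s _ => posSemidef_self_mul_conjTranspose _).add
    (hK.mul_mul_conjTranspose_same F)

theorem modularForm_krausMap_le {K : S → Matrix a m ℂ}
    (hK : (1 - ∑ s, (K s)ᴴ * K s).PosSemidef) {ρ σ : Matrix m m ℂ} {τ : Matrix a a ℂ}
    (hρ : ρ.PosSemidef) (hσ : σ.PosSemidef) (hτ : (τ - krausMap K σ).PosSemidef) {t : ℝ}
    (ht : 0 ≤ t) (X : Matrix a a ℂ) :
    modularForm (krausMap K ρ) τ t X ≤ modularForm ρ σ t (krausMap (fun s => (K s)ᴴ) X) := by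
  have hστ : (σ * krausMap (fun s => (K s)ᴴ) (X * Xᴴ)).trace.re ≤ (τ * (X * Xᴴ)).trace.re := by
    rw [← trace_krausMap_mul, Matrix.trace_mul_comm, Matrix.trace_mul_comm τ]
    exact re_trace_mul_le_of_posSemidef_sub (posSemidef_self_mul_conjTranspose X) hτ
  have hleft := re_trace_mul_le_of_posSemidef_sub hσ
    (posSemidef_krausMap_mul_conjTranspose_sub hK X)
  have hright := re_trace_mul_le_of_posSemidef_sub hρ
    (posSemidef_krausMap_mul_conjTranspose_sub hK Xᴴ)
  simp only [← conjTranspose_krausMap, conjTranspose_conjTranspose] at hright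
  simp only [modularForm, trace_krausMap_mul]
  linarith [mul_le_mul_of_nonneg_left hright ht]

theorem modularForm_eq_sum {ρ σ : Matrix m m ℂ} (hρ : ρ.IsHermitian) (hσ : σ.IsHermitian) (t : ℝ)
    (X : Matrix m m ℂ) :
    modularForm ρ σ t X = ∑ k, ∑ i,
      (2 * hρ.eigenvalues i * (star (eigenCoord hρ hσ 1 k i) * eigenCoord hρ hσ X k i).re
        - (hσ.eigenvalues k + t * hρ.eigenvalues i)
          * Complex.normSq (eigenCoord hρ hσ X k i)) := by
  have hlin := trace_cfc_mul_mul_cfc_mul hρ hσ (fun x => x) (fun _ => 1) X 1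
  have hquad := trace_cfc_mul_mul_cfc_mul hρ hσ (fun _ => 1) (fun x => x) X X
  have hquad' := trace_cfc_mul_mul_cfc_mul hρ hσ (fun x => x) (fun _ => 1) X X
  rw [cfc_one_fun hσ, cfc_id' ℝ ρ, Matrix.one_mul, conjTranspose_one, Matrix.mul_one,
    Matrix.trace_mul_comm] at hlin
  rw [cfc_one_fun hρ, cfc_id' ℝ σ, Matrix.mul_one, Matrix.mul_assoc] at hquad
  rw [cfc_one_fun hσ, cfc_id' ℝ ρ, Matrix.one_mul, Matrix.mul_assoc, Matrix.trace_mul_comm,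
    Matrix.mul_assoc] at hquad'
  simp only [modularForm, hlin, hquad, hquad', Complex.re_sum, Complex.re_ofReal_mul,
    Finset.mul_sum, ← Finset.sum_sub_distrib]
  refine Finset.sum_congr rfl fun k _ => Finset.sum_congr rfl fun i _ => ?_
  simp only [Complex.normSq_apply, Complex.star_def, Complex.mul_re, Complex.conj_re,
    Complex.conj_im]
  ring

theorem two_mul_re_star_mul_sub_le {p e : ℝ} (he : 0 < e) (z w : ℂ) :
    2 * p * (star z * w).re - e * Complex.normSq w ≤ Complex.normSq z * (p ^ 2 / e) := by
  have hsq : Complex.normSq ((p : ℂ) * z - e * w) / e = Complex.normSq z * (p ^ 2 / e)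
      - (2 * p * (star z * w).re - e * Complex.normSq w) := by
    simp only [Complex.normSq_apply, Complex.sub_re, Complex.sub_im, Complex.mul_re,
      Complex.mul_im, Complex.ofReal_re, Complex.ofReal_im, Complex.star_def, Complex.conj_re,
      Complex.conj_im]
    field_simp
    ring
  linarith [div_nonneg (Complex.normSq_nonneg ((p : ℂ) * z - e * w)) he.le]

theorem two_mul_re_star_mul_sub_eq {e : ℝ} (he : e ≠ 0) (p : ℝ) (z : ℂ) :
    2 * p * (star z * ((p / e : ℝ) * z)).re - e * Complex.normSq ((p / e : ℝ) * z)
      = Complex.normSq z * (p ^ 2 / e) := by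
  simp only [Complex.normSq_apply, Complex.star_def, Complex.mul_re, Complex.mul_im,
    Complex.conj_re, Complex.conj_im, Complex.ofReal_re, Complex.ofReal_im]
  field_simp
  ring

theorem isGreatest_range_modularForm {ρ σ : Matrix m m ℂ} (hρ : ρ.PosSemidef) (hσ : σ.PosDef)
    {t : ℝ} (ht : 0 ≤ t) :
    IsGreatest (Set.range (modularForm ρ σ t)) (∑ k, ∑ i, eigenOverlap hρ.1 hσ.1 k i
      * (hρ.1.eigenvalues i ^ 2 / (hσ.1.eigenvalues k + t * hρ.1.eigenvalues i))) := by
  have hpos (k i : m) : 0 < hσ.1.eigenvalues k + t * hρ.1.eigenvalues i :=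
    add_pos_of_pos_of_nonneg (hσ.eigenvalues_pos k) (mul_nonneg ht (hρ.eigenvalues_nonneg i))
  constructor
  · obtain ⟨X, hX⟩ := eigenCoord_surjective hρ.1 hσ.1 (Matrix.of fun k i =>
      ((hρ.1.eigenvalues i / (hσ.1.eigenvalues k + t * hρ.1.eigenvalues i) : ℝ) : ℂ)
        * eigenCoord hρ.1 hσ.1 1 k i)
    refine ⟨X, ?_⟩
    rw [modularForm_eq_sum hρ.1 hσ.1, hX]
    exact Finset.sum_congr rfl fun k _ => Finset.sum_congr rfl fun i _ =>
      two_mul_re_star_mul_sub_eq (hpos k i).ne' _ _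
  · rintro _ ⟨X, rfl⟩
    rw [modularForm_eq_sum hρ.1 hσ.1]
    exact Finset.sum_le_sum fun k _ => Finset.sum_le_sum fun i _ =>
      two_mul_re_star_mul_sub_le (hpos k i) _ _

end ModularForm

section Integration

open Filter Topology

theorem tendsto_mul_log_add_mul_sub_log {p : ℝ} (hp : 0 ≤ p) (y : ℝ) :
    Tendsto (fun t : ℝ => p * (Real.log (y + t * p) - Real.log t)) atTop
      (𝓝 (p * Real.log p)) := by
  rcases hp.eq_or_lt with rfl | hp
  · simp only [zero_mul, tendsto_const_nhds]
  have hlim : Tendsto (fun t : ℝ => y / t + p) atTop (𝓝 p) := by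
    simpa using (tendsto_const_nhds (x := y)).div_atTop tendsto_id |>.add_const p
  refine ((hlim.log hp.ne').congr' ?_).const_mul p
  filter_upwards [hlim.eventually (lt_mem_nhds hp), eventually_gt_atTop 0] with t ht ht0
  have hfactor : y + t * p = t * (y / t + p) := by field_simp
  rw [hfactor, Real.log_mul ht0.ne' ht.ne', add_sub_cancel_left]

theorem hasDerivAt_mul_log_add_mul {p y t : ℝ} (hp : 0 ≤ p) (hy : 0 < y) (ht : 0 ≤ t) :
    HasDerivAt (fun t : ℝ => p * Real.log (y + t * p)) (p ^ 2 / (y + t * p)) t := by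
  have hlin : HasDerivAt (fun t : ℝ => y + t * p) p t := by
    simpa using ((hasDerivAt_id t).mul_const p).const_add y
  exact ((hlin.log (add_pos_of_pos_of_nonneg hy (mul_nonneg ht hp)).ne').const_mul p).congr_deriv
    (by ring)

variable {α β : Type*} [Fintype α] [Fintype β] {w p y : α → ℝ} {w' p' y' : β → ℝ}

theorem tendsto_sum_mul_log_add_mul_sub_log (hp : ∀ i, 0 ≤ p i) :
    Tendsto (fun t : ℝ => ∑ i, w i * (p i * Real.log (y i + t * p i))
      - (∑ i, w i * p i) * Real.log t) atTop (𝓝 (∑ i, w i * (p i * Real.log (p i)))) := by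
  refine (tendsto_finsetSum Finset.univ fun i _ =>
    (tendsto_mul_log_add_mul_sub_log (hp i) (y i)).const_mul (w i)).congr fun t => ?_
  rw [Finset.sum_mul, ← Finset.sum_sub_distrib]
  exact Finset.sum_congr rfl fun i _ => by ring

theorem sum_mul_log_sub_log_le (hp : ∀ i, 0 ≤ p i) (hy : ∀ i, 0 < y i)
    (hp' : ∀ i, 0 ≤ p' i) (hy' : ∀ i, 0 < y' i) (hsum : ∑ i, w i * p i = ∑ i, w' i * p' i)
    (h : ∀ t : ℝ, 0 ≤ t → ∑ i, w i * (p i ^ 2 / (y i + t * p i))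
      ≤ ∑ i, w' i * (p' i ^ 2 / (y' i + t * p' i))) :
    ∑ i, w i * (p i * (Real.log (p i) - Real.log (y i)))
      ≤ ∑ i, w' i * (p' i * (Real.log (p' i) - Real.log (y' i))) := by
  set g : ℝ → ℝ := fun t => ∑ i, w' i * (p' i * Real.log (y' i + t * p' i))
    - ∑ i, w i * (p i * Real.log (y i + t * p i)) with hg
  have hderiv (t : ℝ) (ht : 0 ≤ t) : HasDerivAt g (∑ i, w' i * (p' i ^ 2 / (y' i + t * p' i))
      - ∑ i, w i * (p i ^ 2 / (y i + t * p i))) t :=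
    (HasDerivAt.fun_sum fun i _ =>
        (hasDerivAt_mul_log_add_mul (hp' i) (hy' i) ht).const_mul (w' i)).sub
      (HasDerivAt.fun_sum fun i _ => (hasDerivAt_mul_log_add_mul (hp i) (hy i) ht).const_mul (w i))
  have hmono : MonotoneOn g (Set.Ici 0) := by
    refine monotoneOn_of_hasDerivWithinAt_nonneg (convex_Ici 0)
      (fun t ht => (hderiv t ht).continuousAt.continuousWithinAt)
      (fun t ht => (hderiv t (interior_subset ht)).hasDerivWithinAt)
      (fun t ht => sub_nonneg.2 (h t (interior_subset ht)))
  have hlim : Tendsto g atTop (𝓝 (∑ i, w' i * (p' i * Real.log (p' i))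
      - ∑ i, w i * (p i * Real.log (p i)))) := by
    refine ((tendsto_sum_mul_log_add_mul_sub_log (w := w') (y := y') hp').sub
      (tendsto_sum_mul_log_add_mul_sub_log (w := w) (y := y) hp)).congr fun t => ?_
    rw [hg, hsum]
    ring
  have hg0 : g 0 ≤ ∑ i, w' i * (p' i * Real.log (p' i)) - ∑ i, w i * (p i * Real.log (p i)) :=
    ge_of_tendsto hlim ((eventually_ge_atTop 0).mono fun t ht => hmono Set.self_mem_Ici ht ht)
  simp only [hg, zero_mul, add_zero] at hg0
  simp only [mul_sub, Finset.sum_sub_distrib]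
  linarith

end Integration

section DataProcessing

variable {m a b S R : Type*} [Fintype m] [DecidableEq m] [Fintype a] [DecidableEq a]
  [Fintype b] [DecidableEq b] [Fintype S] [Fintype R]

theorem sum_eigenOverlap_mul_eigenvalues {ρ σ : Matrix m m ℂ} (hρ : ρ.IsHermitian)
    (hσ : σ.IsHermitian) :
    ∑ k, ∑ i, eigenOverlap hρ hσ k i * hρ.eigenvalues i = ρ.trace.re := by
  have h := re_trace_cfc_mul_cfc hρ hσ (fun x => x) (fun _ => 1)
  rw [cfc_one_fun hσ, cfc_id' ℝ ρ, Matrix.mul_one] at h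
  simp only [h, mul_one]

theorem relEntropy_krausMap_le {K : S → Matrix a m ℂ} (hK : (1 - ∑ s, (K s)ᴴ * K s).PosSemidef)
    {ρ σ : Matrix m m ℂ} {τ : Matrix a a ℂ} (hρ : ρ.PosSemidef) (hσ : σ.PosDef) (hτ : τ.PosDef)
    (htr : (krausMap K ρ).trace = ρ.trace) (hστ : (τ - krausMap K σ).PosSemidef) :
    relEntropy (krausMap K ρ) τ ≤ relEntropy ρ σ := by
  have hKρ := posSemidef_krausMap K hρ
  have hform (t : ℝ) (ht : 0 ≤ t) :
      ∑ k, ∑ i, eigenOverlap hKρ.1 hτ.1 k i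
          * (hKρ.1.eigenvalues i ^ 2 / (hτ.1.eigenvalues k + t * hKρ.1.eigenvalues i))
        ≤ ∑ k, ∑ i, eigenOverlap hρ.1 hσ.1 k i
          * (hρ.1.eigenvalues i ^ 2 / (hσ.1.eigenvalues k + t * hρ.1.eigenvalues i)) := by
    obtain ⟨X, hX⟩ := (isGreatest_range_modularForm hKρ hτ ht).1
    exact hX.ge.trans ((modularForm_krausMap_le hK hρ hσ.posSemidef hστ ht X).trans
      ((isGreatest_range_modularForm hρ hσ ht).2 ⟨_, rfl⟩))
  rw [relEntropy_eq_sum hKρ.1 hτ.1, relEntropy_eq_sum hρ.1 hσ.1]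
  have hsum : ∑ k, ∑ i, eigenOverlap hKρ.1 hτ.1 k i * hKρ.1.eigenvalues i
      = ∑ k, ∑ i, eigenOverlap hρ.1 hσ.1 k i * hρ.1.eigenvalues i := by
    rw [sum_eigenOverlap_mul_eigenvalues, sum_eigenOverlap_mul_eigenvalues, htr]
  simp only [← Fintype.sum_prod_type'] at hform hsum ⊢
  exact sum_mul_log_sub_log_le (fun z => hKρ.eigenvalues_nonneg z.2)
    (fun z => hτ.eigenvalues_pos z.1) (fun z => hρ.eigenvalues_nonneg z.2)
    (fun z => hσ.eigenvalues_pos z.1) hsum hform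

theorem posSemidef_one_sub_mul_conjTranspose {V : Matrix a m ℂ} (hV : Vᴴ * V = 1) :
    (1 - V * Vᴴ).PosSemidef := by
  have h : 1 - V * Vᴴ = (1 - V * Vᴴ)ᴴ * (1 - V * Vᴴ) := by
    have hproj : V * Vᴴ * (V * Vᴴ) = V * Vᴴ := by
      rw [Matrix.mul_assoc, ← Matrix.mul_assoc Vᴴ, hV, Matrix.one_mul]
    simp only [conjTranspose_sub, conjTranspose_one, conjTranspose_mul,
      conjTranspose_conjTranspose, Matrix.mul_sub, Matrix.sub_mul, Matrix.mul_one, Matrix.one_mul,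
      hproj, sub_self, sub_zero]
  rw [h]
  exact posSemidef_conjTranspose_mul_self _

theorem relEntropy_stinespring_conj [DecidableEq S] {K : S → Matrix a m ℂ}
    (hK : ∑ s, (K s)ᴴ * K s = 1) {ρ : Matrix m m ℂ} {ω : Matrix a a ℂ} (hρ : ρ.IsHermitian)
    (hω : ω.IsHermitian) :
    relEntropy (stinespring K * ρ * (stinespring K)ᴴ) (ω ⊗ₖ (1 : Matrix S S ℂ))
      = -vonNeumannEntropy ρ - (krausMap K ρ * cfc Real.log ω).trace.re := by
  have hV : (stinespring K)ᴴ * stinespring K = 1 := by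
    rw [conjTranspose_stinespring_mul_self, hK]
  rw [relEntropy, vonNeumannEntropy_isometry_conj hV hρ, cfc_kronecker_one _ hω,
    trace_krausMap_mul, ← conjTranspose_stinespring_mul_mul, Matrix.mul_assoc,
    Matrix.mul_assoc, Matrix.trace_mul_comm]
  simp only [Matrix.mul_assoc]

theorem relEntropy_krausMap_le_neg_entropy_sub {K : S → Matrix a m ℂ} {L : R → Matrix b m ℂ}
    (hK : ∀ X, (krausMap K X).trace = X.trace) (hL : ∀ X, (krausMap L X).trace = X.trace)
    {ρ : Matrix m m ℂ} {ω : Matrix a a ℂ} {τ : Matrix b b ℂ} (hρ : ρ.PosSemidef) (hω : ω.PosDef)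
    (hτ : τ.PosDef) (hωτ : (τ - krausMap L (krausMap (fun s => (K s)ᴴ) ω)).PosSemidef) :
    relEntropy (krausMap L ρ) τ
      ≤ -vonNeumannEntropy ρ - (krausMap K ρ * cfc Real.log ω).trace.re := by
  classical
  have hKsum := sum_conjTranspose_mul_eq_one hK
  set V := stinespring K
  have hV : Vᴴ * V = 1 := by rw [conjTranspose_stinespring_mul_self, hKsum]
  have hLV (X : Matrix (a × S) (a × S) ℂ) :
      krausMap (fun r => L r * Vᴴ) X = krausMap L (Vᴴ * X * V) := by
    simp only [krausMap_apply, conjTranspose_mul, conjTranspose_conjTranspose, Matrix.mul_assoc]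
  have hLVρ : krausMap (fun r => L r * Vᴴ) (V * ρ * Vᴴ) = krausMap L ρ := by
    rw [hLV, ← Matrix.mul_assoc, ← Matrix.mul_assoc, hV, Matrix.one_mul, Matrix.mul_assoc, hV,
      Matrix.mul_one]
  have hcontr : (1 - ∑ r, (L r * Vᴴ)ᴴ * (L r * Vᴴ)).PosSemidef := by
    have hsum : ∑ r, (L r * Vᴴ)ᴴ * (L r * Vᴴ) = V * (∑ r, (L r)ᴴ * L r) * Vᴴ := by
      simp only [Matrix.mul_sum, Matrix.sum_mul, conjTranspose_mul, conjTranspose_conjTranspose,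
        Matrix.mul_assoc]
    rw [hsum, sum_conjTranspose_mul_eq_one hL, Matrix.mul_one]
    exact posSemidef_one_sub_mul_conjTranspose hV
  have htr : (krausMap (fun r => L r * Vᴴ) (V * ρ * Vᴴ)).trace = (V * ρ * Vᴴ).trace := by
    rw [hLVρ, hL, Matrix.trace_mul_comm, ← Matrix.mul_assoc, hV, Matrix.one_mul]
  rw [← relEntropy_stinespring_conj hKsum hρ.1 hω.1, ← hLVρ]
  refine relEntropy_krausMap_le hcontr (hρ.mul_mul_conjTranspose_same V)
    (hω.kronecker PosDef.one) hτ htr ?_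
  rwa [hLV, conjTranspose_stinespring_mul_mul]

end DataProcessing

section SchattenNorms

variable {m : Type*} [Fintype m]

theorem re_trace_conjTranspose_mul_self (X : Matrix m m ℂ) :
    (Xᴴ * X).trace.re = ∑ j, ∑ i, ‖X i j‖ ^ 2 := by
  simp only [Matrix.trace, Matrix.diag_apply, Matrix.mul_apply, conjTranspose_apply,
    Complex.re_sum, Complex.star_def, ← Complex.normSq_eq_conj_mul_self, Complex.ofReal_re,
    Complex.normSq_eq_norm_sq]

theorem hilbertSchmidtNorm_eq_one_iff {X : Matrix m m ℂ} :
    hilbertSchmidtNorm X = 1 ↔ (Xᴴ * X).trace = 1 := by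
  rw [hilbertSchmidtNorm, Real.sqrt_eq_one]
  refine ⟨fun h => Complex.ext h ?_, fun h => by rw [h, Complex.one_re]⟩
  exact (Complex.nonneg_iff.1 (posSemidef_conjTranspose_mul_self X).trace_nonneg).2.symm

theorem norm_apply_le_hilbertSchmidtNorm (X : Matrix m m ℂ) (s t : m) :
    ‖X s t‖ ≤ hilbertSchmidtNorm X := by
  refine Real.le_sqrt_of_sq_le ?_
  rw [re_trace_conjTranspose_mul_self]
  calc ‖X s t‖ ^ 2 ≤ ∑ i, ‖X i t‖ ^ 2 :=
        Finset.single_le_sum (f := fun i => ‖X i t‖ ^ 2) (fun _ _ => sq_nonneg _)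
          (Finset.mem_univ s)
    _ ≤ ∑ j, ∑ i, ‖X i j‖ ^ 2 :=
        Finset.single_le_sum (f := fun j => ∑ i, ‖X i j‖ ^ 2)
          (fun _ _ => Finset.sum_nonneg fun _ _ => sq_nonneg _) (Finset.mem_univ t)

variable [DecidableEq m]

theorem hilbertSchmidtNorm_le_traceNorm (X : Matrix m m ℂ) :
    hilbertSchmidtNorm X ≤ traceNorm X := by
  have hX := posSemidef_conjTranspose_mul_self X
  have htr : (Xᴴ * X).trace.re = ∑ i, √(hX.isHermitian.eigenvalues i) ^ 2 := by
    simp only [hX.isHermitian.trace_eq_sum_eigenvalues, Real.sq_sqrt (hX.eigenvalues_nonneg _),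
      Complex.re_sum, RCLike.ofReal_eq_complex_ofReal, Complex.ofReal_re]
  rw [hilbertSchmidtNorm, traceNorm, re_trace_cfc hX.isHermitian, htr]
  have hnonneg : ∀ i ∈ Finset.univ, 0 ≤ √(hX.isHermitian.eigenvalues i) :=
    fun i _ => Real.sqrt_nonneg _
  exact (Real.sqrt_le_sqrt (Finset.sum_sq_le_sq_sum_of_nonneg hnonneg)).trans_eq
    (Real.sqrt_sq (Finset.sum_nonneg hnonneg))

theorem traceNorm_of_isIdempotentElem {X : Matrix m m ℂ} (h : IsIdempotentElem (Xᴴ * X)) :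
    traceNorm X = (Xᴴ * X).trace.re := by
  have hsqrt : (spectrum ℝ (Xᴴ * X)).EqOn Real.sqrt fun x => x := by
    intro x hx
    rcases h.spectrum_subset ℝ hx with rfl | rfl
    · exact Real.sqrt_zero
    · exact Real.sqrt_one
  have hid : cfc (fun x : ℝ => x) (Xᴴ * X) = Xᴴ * X :=
    cfc_id' ℝ _ (isHermitian_conjTranspose_mul_self X)
  rw [traceNorm, cfc_congr hsqrt, hid]

theorem traceNorm_vecMulVec {α β : m → ℂ} (hα : star α ⬝ᵥ α = 1) (hβ : star β ⬝ᵥ β = 1) :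
    traceNorm (vecMulVec α β) = 1 := by
  have hβ' : β ⬝ᵥ star β = 1 := by rw [dotProduct_comm, hβ]
  have h : (vecMulVec α β)ᴴ * vecMulVec α β = vecMulVec (star β) β := by
    rw [conjTranspose_vecMulVec, vecMulVec_mul_vecMulVec, hα, one_smul]
  rw [traceNorm_of_isIdempotentElem, h, trace_vecMulVec, hβ, Complex.one_re]
  rw [IsIdempotentElem, h, vecMulVec_mul_vecMulVec, hβ', one_smul]

open scoped MatrixOrder Matrix.Norms.L2Operator in
theorem posSemidef_smul_one_sub {J : Matrix m m ℂ} (hJ : J.IsHermitian) {c : ℝ}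
    (hc : operatorNorm J ≤ c) : (c • (1 : Matrix m m ℂ) - J).PosSemidef := by
  have h : J ≤ algebraMap ℝ (Matrix m m ℂ) ‖J‖ := IsSelfAdjoint.le_algebraMap_norm_self hJ
  rw [← Algebra.algebraMap_eq_smul_one]
  exact Matrix.le_iff.1 (h.trans (algebraMap_mono _ hc))

end SchattenNorms

section CbNorm

variable {a b : Type*} [Fintype a] [DecidableEq a] [Fintype b] [DecidableEq b]

theorem matrixNormS1_vecMulVec_maxEntVec_le {n : ℕ} (e : a ≃ Fin n) :
    matrixNormS1 n (vecMulVec (maxEntVec e) (star (maxEntVec e))) ≤ 1 := by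
  refine iSup_le fun u => iSup_le fun v => iSup_le fun hu => iSup_le fun hv => ?_
  have hα (i : a) (p : Fin n) : (((1 : Matrix a a ℂ) ⊗ₖ u) *ᵥ maxEntVec e) (i, p) = u p (e i) := by
    simp [Matrix.mulVec, dotProduct, Fintype.sum_prod_type, Matrix.one_apply, maxEntVec]
  have hβ (i : a) (p : Fin n) :
      (star (maxEntVec e) ᵥ* ((1 : Matrix a a ℂ) ⊗ₖ v)) (i, p) = v (e i) p := by
    simp [Matrix.vecMul, dotProduct, Fintype.sum_prod_type, Matrix.one_apply, maxEntVec]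
  rw [Matrix.mul_vecMulVec, Matrix.vecMulVec_mul, traceNorm_vecMulVec, ENNReal.ofReal_one]
  · rw [← hilbertSchmidtNorm_eq_one_iff.1 hu]
    simp only [dotProduct, Fintype.sum_prod_type, Pi.star_apply, hα, Matrix.trace,
      Matrix.diag_apply, Matrix.mul_apply, conjTranspose_apply]
    exact e.sum_comp fun i => ∑ p, star (u p i) * u p i
  · rw [← hilbertSchmidtNorm_eq_one_iff.1 hv]
    simp only [dotProduct, Fintype.sum_prod_type, Pi.star_apply, hβ, Matrix.trace,
      Matrix.diag_apply, Matrix.mul_apply, conjTranspose_apply]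
    rw [e.sum_comp fun i => ∑ p, star (v i p) * v i p, Finset.sum_comm]

theorem operatorNorm_choi_le_cbNorm {n : ℕ} (e : a ≃ Fin n)
    (T : Matrix a a ℂ →ₗ[ℂ] Matrix b b ℂ) :
    ENNReal.ofReal (operatorNorm (choi e T)) ≤ cbNorm T :=
  le_iSup_of_le n <| le_iSup_of_le _ <|
    le_iSup_of_le (matrixNormS1_vecMulVec_maxEntVec_le e) le_rfl

theorem cbNorm_pos {T : Matrix a a ℂ →ₗ[ℂ] Matrix b b ℂ} (hT : T ≠ 0) : 0 < cbNorm T := by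
  let e := Fintype.equivFin a
  refine lt_of_lt_of_le ?_ (operatorNorm_choi_le_cbNorm e T)
  have hchoi : choi e T ≠ choi e 0 := (choi_injective e).ne hT
  have hzero : choi e (0 : Matrix a a ℂ →ₗ[ℂ] Matrix b b ℂ) = 0 := rfl
  rw [ENNReal.ofReal_pos, operatorNorm, norm_pos_iff]
  exact (EmbeddingLike.map_ne_zero_iff (f := toEuclideanCLM (𝕜 := ℂ))).2 (hzero ▸ hchoi)

theorem traceNorm_le_one_of_matrixNormS1_le_one {n : ℕ}
    {X : Matrix (a × Fin n) (a × Fin n) ℂ} (hX : matrixNormS1 n X ≤ 1)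
    {u v : Matrix (Fin n) (Fin n) ℂ} (hu : hilbertSchmidtNorm u = 1)
    (hv : hilbertSchmidtNorm v = 1) :
    traceNorm (((1 : Matrix a a ℂ) ⊗ₖ u) * X * ((1 : Matrix a a ℂ) ⊗ₖ v)) ≤ 1 := by
  refine ENNReal.ofReal_le_one.1 (le_trans ?_ hX)
  exact le_iSup_of_le u <| le_iSup_of_le v <| le_iSup_of_le hu <| le_iSup_of_le hv le_rfl

theorem submatrix_one_kronecker_mul_mul {k : Type*} [Fintype k]
    (u v : Matrix k k ℂ) (X : Matrix (a × k) (a × k) ℂ) (i j : a) :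
    (((1 : Matrix a a ℂ) ⊗ₖ u) * X * ((1 : Matrix a a ℂ) ⊗ₖ v)).submatrix (Prod.mk i) (Prod.mk j)
      = u * X.submatrix (Prod.mk i) (Prod.mk j) * v := by
  ext p q
  simp only [submatrix_apply, Matrix.mul_apply, kroneckerMap_apply, Fintype.sum_prod_type,
    Matrix.one_apply, ite_mul, one_mul, zero_mul, mul_ite, mul_zero, Finset.sum_ite_irrel,
    Finset.sum_const_zero, Finset.sum_ite_eq, Finset.sum_ite_eq', Finset.mem_univ, if_true]

theorem norm_dotProduct_submatrix_mulVec_le {n : ℕ} {X : Matrix (a × Fin n) (a × Fin n) ℂ}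
    (hX : matrixNormS1 n X ≤ 1) (i j : a) {ξ η : Fin n → ℂ} (hξ : star ξ ⬝ᵥ ξ = 1)
    (hη : star η ⬝ᵥ η = 1) :
    ‖ξ ⬝ᵥ X.submatrix (Prod.mk i) (Prod.mk j) *ᵥ η‖ ≤ 1 := by
  have hn : Nonempty (Fin n) := by
    by_contra hn
    rw [not_nonempty_iff] at hn
    simp [dotProduct] at hξ
  obtain ⟨r⟩ := hn
  set δ : Fin n → ℂ := Pi.single r 1
  have hu : hilbertSchmidtNorm (vecMulVec δ ξ) = 1 := by
    rw [hilbertSchmidtNorm_eq_one_iff, conjTranspose_vecMulVec, vecMulVec_mul_vecMulVec,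
      trace_vecMulVec, dotProduct_smul, hξ]
    simp [δ]
  have hv : hilbertSchmidtNorm (vecMulVec η δ) = 1 := by
    rw [hilbertSchmidtNorm_eq_one_iff, conjTranspose_vecMulVec, vecMulVec_mul_vecMulVec,
      hη, one_smul, trace_vecMulVec]
    simp [δ]
  have hentry : (((1 : Matrix a a ℂ) ⊗ₖ vecMulVec δ ξ) * X
      * ((1 : Matrix a a ℂ) ⊗ₖ vecMulVec η δ)) (i, r) (j, r)
        = ξ ⬝ᵥ X.submatrix (Prod.mk i) (Prod.mk j) *ᵥ η := by
    have h := congrFun₂ (submatrix_one_kronecker_mul_mul (vecMulVec δ ξ) (vecMulVec η δ) X i j) r r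
    rw [submatrix_apply] at h
    rw [h, vecMulVec_mul, vecMulVec_mul_vecMulVec]
    simp [δ, vecMulVec_apply, dotProduct_mulVec]
  rw [← hentry]
  exact ((norm_apply_le_hilbertSchmidtNorm _ _ _).trans (hilbertSchmidtNorm_le_traceNorm _)).trans
    (traceNorm_le_one_of_matrixNormS1_le_one hX hu hv)

theorem operatorNorm_submatrix_le_one {n : ℕ} {X : Matrix (a × Fin n) (a × Fin n) ℂ}
    (hX : matrixNormS1 n X ≤ 1) (i j : a) :
    operatorNorm (X.submatrix (Prod.mk i) (Prod.mk j)) ≤ 1 := by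
  refine ContinuousLinearMap.opNorm_le_of_re_inner_le zero_le_one fun x y hx hy => ?_
  have hunit {z : EuclideanSpace ℂ (Fin n)} (hz : ‖z‖ = 1) : star z.ofLp ⬝ᵥ z.ofLp = 1 := by
    rw [dotProduct_comm, ← EuclideanSpace.inner_eq_star_dotProduct, inner_self_eq_norm_sq_to_K, hz]
    simp
  rw [← inner_conj_symm, RCLike.conj_re, EuclideanSpace.inner_eq_star_dotProduct,
    ofLp_toEuclideanCLM, dotProduct_comm]
  refine (RCLike.re_le_norm _).trans (norm_dotProduct_submatrix_mulVec_le hX i j ?_ (hunit hx))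
  rw [star_star, dotProduct_comm, hunit hy]

theorem ampliation_eq_sum {a b k : Type*} [Fintype a] [DecidableEq a]
    (T : Matrix a a ℂ →ₗ[ℂ] Matrix b b ℂ) (X : Matrix (a × k) (a × k) ℂ) :
    ampliation k T X
      = ∑ i, ∑ j, T (Matrix.single i j 1) ⊗ₖ X.submatrix (Prod.mk i) (Prod.mk j) := by
  ext ⟨x, p⟩ ⟨y, q⟩
  rw [ampliation, Matrix.of_apply, Matrix.matrix_eq_sum_single (Matrix.of _)]
  simp only [map_sum, Matrix.sum_apply, kroneckerMap_apply, submatrix_apply, Matrix.of_apply]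
  refine Finset.sum_congr rfl fun i _ => Finset.sum_congr rfl fun j _ => ?_
  rw [← mul_one (X (i, p) (j, q)), ← smul_eq_mul, ← Matrix.smul_single, map_smul,
    Matrix.smul_apply, smul_eq_mul, smul_eq_mul, mul_one, mul_comm]

open scoped Matrix.Norms.L2Operator in
theorem operatorNorm_kronecker_le (X : Matrix a a ℂ) (Y : Matrix b b ℂ) :
    operatorNorm (X ⊗ₖ Y) ≤ operatorNorm X * operatorNorm Y := by
  have h : X ⊗ₖ Y = kroneckerOne a b X * oneKronecker a b Y := by
    change _ = (X ⊗ₖ 1) * (1 ⊗ₖ Y)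
    rw [← mul_kronecker_mul, Matrix.mul_one, Matrix.one_mul]
  calc ‖X ⊗ₖ Y‖ ≤ ‖kroneckerOne a b X‖ * ‖oneKronecker a b Y‖ := h ▸ norm_mul_le _ _
    _ ≤ ‖X‖ * ‖Y‖ := by
      gcongr <;> exact NonUnitalStarAlgHom.norm_apply_le _ _

open scoped Matrix.Norms.L2Operator in
theorem operatorNorm_ampliation_le {n : ℕ} {X : Matrix (a × Fin n) (a × Fin n) ℂ}
    (hX : matrixNormS1 n X ≤ 1) (T : Matrix a a ℂ →ₗ[ℂ] Matrix b b ℂ) :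
    operatorNorm (ampliation (Fin n) T X)
      ≤ ∑ i, ∑ j, operatorNorm (T (Matrix.single i j 1)) := by
  let block i j := X.submatrix (Prod.mk i) (Prod.mk j)
  calc operatorNorm (ampliation (Fin n) T X)
      = ‖∑ i, ∑ j, T (Matrix.single i j 1) ⊗ₖ block i j‖ := by rw [ampliation_eq_sum]; rfl
    _ ≤ ∑ i, ∑ j, ‖T (Matrix.single i j 1) ⊗ₖ block i j‖ :=
      (norm_sum_le _ _).trans (Finset.sum_le_sum fun i _ => norm_sum_le _ _)
    _ ≤ ∑ i, ∑ j, operatorNorm (T (Matrix.single i j 1)) :=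
      Finset.sum_le_sum fun i _ => Finset.sum_le_sum fun j _ =>
        (operatorNorm_kronecker_le _ _).trans
          (mul_le_of_le_one_right (norm_nonneg _) (operatorNorm_submatrix_le_one hX i j))

theorem cbNorm_lt_top (T : Matrix a a ℂ →ₗ[ℂ] Matrix b b ℂ) : cbNorm T < ⊤ := by
  refine lt_of_le_of_lt ?_ (ENNReal.ofReal_lt_top
    (r := ∑ i, ∑ j, operatorNorm (T (Matrix.single i j 1))))
  exact iSup_le fun n => iSup_le fun X => iSup_le fun hX =>
    ENNReal.ofReal_le_ofReal (operatorNorm_ampliation_le hX T)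

end CbNorm

section TraceDefect

variable {a b : Type*} [Fintype a] [DecidableEq b]

/-- The map `Y ↦ c tr(Y) 1 - T Y`, which is completely positive exactly when `c • 1` dominates the
Choi matrix of `T`. -/
noncomputable def traceDefect (c : ℝ) (T : Matrix a a ℂ →ₗ[ℂ] Matrix b b ℂ) :
    Matrix a a ℂ →ₗ[ℂ] Matrix b b ℂ :=
  c • (Matrix.traceLinearMap a ℂ ℂ).smulRight (1 : Matrix b b ℂ) - T

theorem ampliation_traceDefect {k : Type*} (c : ℝ) (T : Matrix a a ℂ →ₗ[ℂ] Matrix b b ℂ)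
    (Y : Matrix (a × k) (a × k) ℂ) :
    ampliation k (traceDefect c T) Y
      = c • ((1 : Matrix b b ℂ) ⊗ₖ partialTraceLeft Y) - ampliation k T Y := by
  ext ⟨x, p⟩ ⟨y, q⟩
  simp only [ampliation, traceDefect, LinearMap.sub_apply, LinearMap.smul_apply,
    LinearMap.smulRight_apply, Matrix.traceLinearMap_apply, Matrix.sub_apply, Matrix.smul_apply,
    smul_eq_mul, Matrix.of_apply, kroneckerMap_apply, partialTraceLeft, Matrix.trace,
    Matrix.diag_apply]
  exact congrArg (fun z : ℂ => c • z - _) (mul_comm _ _)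

theorem choi_traceDefect {n : ℕ} (e : a ≃ Fin n) (c : ℝ) (T : Matrix a a ℂ →ₗ[ℂ] Matrix b b ℂ) :
    choi e (traceDefect c T) = c • (1 : Matrix (b × Fin n) (b × Fin n) ℂ) - choi e T := by
  have htrace : partialTraceLeft (vecMulVec (maxEntVec e) (star (maxEntVec e))) = 1 := by
    ext p q
    simp only [partialTraceLeft, Matrix.of_apply, vecMulVec_apply, maxEntVec, Pi.star_apply]
    rw [e.sum_comp fun r => (if r = p then 1 else 0) * star (if r = q then (1 : ℂ) else 0)]
    simp [Matrix.one_apply, eq_comm]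
  rw [choi, ampliation_traceDefect, htrace, one_kronecker_one, choi]

theorem posSemidef_cbNorm_smul_one_kronecker_sub_ampliation [DecidableEq a] [Fintype b]
    {T : Matrix a a ℂ →ₗ[ℂ] Matrix b b ℂ} (hT : IsCompletelyPositive T) {k : Type*} [Finite k]
    {Y : Matrix (a × k) (a × k) ℂ} (hY : Y.PosSemidef) :
    ((cbNorm T).toReal • ((1 : Matrix b b ℂ) ⊗ₖ partialTraceLeft Y)
      - ampliation k T Y).PosSemidef := by
  classical
  have := Fintype.ofFinite k
  let e := Fintype.equivFin a
  have hJ : (choi e T).PosSemidef := hT _ _ (posSemidef_vecMulVec_self_star _)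
  have hc : operatorNorm (choi e T) ≤ (cbNorm T).toReal :=
    (ENNReal.ofReal_le_iff_le_toReal (cbNorm_lt_top T).ne).1 (operatorNorm_choi_le_cbNorm e T)
  have hdefect := posSemidef_smul_one_sub hJ.isHermitian hc
  rw [← choi_traceDefect] at hdefect
  obtain ⟨D, hD⟩ := exists_eq_krausMap_of_posSemidef_choi e hdefect
  rw [← ampliation_traceDefect, hD, ampliation_krausMap]
  exact posSemidef_krausMap _ hY

end TraceDefect

section UncertaintyRelation

theorem IsDensityOperator.nonempty {m : Type*} [Fintype m] {ρ : Matrix m m ℂ}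
    (hρ : IsDensityOperator ρ) : Nonempty m := by
  by_contra h
  rw [not_nonempty_iff] at h
  simpa [Matrix.trace] using hρ.trace_eq_one

variable {M A B C : Type*} [Fintype M] [Fintype A]
  {ΦA : Matrix M M ℂ →ₗ[ℂ] Matrix A A ℂ}

theorem IsQuantumChannel.nonempty [Nonempty M] (hA : IsQuantumChannel ΦA) : Nonempty A := by
  classical
  by_contra h
  rw [not_nonempty_iff] at h
  simpa [Matrix.trace, eq_comm] using hA.trace_map 1

variable [DecidableEq M] [Fintype B] [Fintype C] [DecidableEq C]

theorem comp_traceAdjoint_ne_zero [Nonempty M]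
    {ΦB : Matrix M M ℂ →ₗ[ℂ] Matrix B B ℂ} (hA : IsQuantumChannel ΦA)
    (hB : IsQuantumChannel ΦB) : ΦB ∘ₗ traceAdjoint ΦA ≠ 0 := by
  classical
  obtain ⟨K, rfl⟩ := hA.completelyPositive.exists_eq_krausMap
  intro h
  have htrace := congrArg Matrix.trace (LinearMap.congr_fun h 1)
  rw [LinearMap.comp_apply, hB.trace_map, traceAdjoint_krausMap, krausMap_apply] at htrace
  simp only [Matrix.mul_one, conjTranspose_conjTranspose,
    sum_conjTranspose_mul_eq_one hA.trace_map] at htrace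
  simp at htrace

theorem ampliation_traceAdjoint_krausMap {S : Type*} [Fintype S] (K : S → Matrix A M ℂ)
    (Y : Matrix (A × C) (A × C) ℂ) :
    ampliation C (traceAdjoint (krausMap K)) Y
      = krausMap (fun s => (K s ⊗ₖ (1 : Matrix C C ℂ))ᴴ) Y := by
  simp only [traceAdjoint_krausMap, ampliation_krausMap, conjTranspose_kronecker,
    conjTranspose_one]

variable [DecidableEq A] [DecidableEq B] {ΦB : Matrix M M ℂ →ₗ[ℂ] Matrix B B ℂ}

theorem toReal_cbNorm_comp_traceAdjoint_pos [Nonempty M] (hA : IsQuantumChannel ΦA)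
    (hB : IsQuantumChannel ΦB) : 0 < (cbNorm (ΦB ∘ₗ traceAdjoint ΦA)).toReal :=
  ENNReal.toReal_pos (cbNorm_pos (comp_traceAdjoint_ne_zero hA hB)).ne' (cbNorm_lt_top _).ne

theorem re_trace_mul_log_smul_one_kronecker (X : Matrix (B × C) (B × C) ℂ) {R : Matrix C C ℂ}
    (hR : R.PosDef) {c : ℝ} (hc : 0 < c) :
    (X * cfc Real.log (c • ((1 : Matrix B B ℂ) ⊗ₖ R))).trace.re
      = Real.log c * X.trace.re + (partialTraceLeft X * cfc Real.log R).trace.re := by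
  have hpos : ((1 : Matrix B B ℂ) ⊗ₖ R).PosDef := PosDef.one.kronecker hR
  have hlog : cfc Real.log (c • ((1 : Matrix B B ℂ) ⊗ₖ R))
      = Real.log c • 1 + (1 : Matrix B B ℂ) ⊗ₖ cfc Real.log R := by
    rw [← cfc_one_kronecker _ hR.isHermitian, ← Algebra.algebraMap_eq_smul_one]
    open scoped Matrix.Norms.L2Operator in
    exact CFC.log_smul _ (fun x hx h0 => spectrum.zero_notMem ℝ hpos.isUnit (h0 ▸ hx)) hc.ne'
      hpos.isHermitian
  rw [hlog, Matrix.mul_add, trace_add, trace_mul_one_kronecker, Complex.add_re, Matrix.mul_smul,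
    Matrix.mul_one, trace_smul, Complex.smul_re, smul_eq_mul]

theorem entropy_uncertainty_regularized [Nonempty M] (hA : IsQuantumChannel ΦA)
    (hB : IsQuantumChannel ΦB) {ρ : Matrix (M × C) (M × C) ℂ} (hρ : ρ.PosSemidef) {ε : ℝ}
    (hε : 0 < ε) :
    -vonNeumannEntropy (ampliation C ΦB ρ)
        - (Real.log (cbNorm (ΦB ∘ₗ traceAdjoint ΦA)).toReal * ρ.trace.re
          + (partialTraceLeft ρ
            * cfc Real.log (partialTraceLeft ρ + (Fintype.card A * ε) • 1)).trace.re)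
      ≤ -vonNeumannEntropy ρ
        - (ampliation C ΦA ρ * cfc Real.log (ampliation C ΦA ρ + ε • 1)).trace.re := by
  have : Nonempty A := hA.nonempty
  have hc := toReal_cbNorm_comp_traceAdjoint_pos hA hB
  obtain ⟨K, rfl⟩ := hA.completelyPositive.exists_eq_krausMap
  obtain ⟨L, rfl⟩ := hB.completelyPositive.exists_eq_krausMap
  have hω : (ampliation C (krausMap K) ρ + ε • 1).PosDef :=
    (PosDef.one.smul hε).posSemidef_add (ampliation_krausMap K ρ ▸ posSemidef_krausMap _ hρ)
  have hR : (partialTraceLeft ρ + (Fintype.card A * ε) • 1).PosDef :=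
    (PosDef.one.smul (mul_pos (Nat.cast_pos.2 Fintype.card_pos) hε)).posSemidef_add
      (posSemidef_partialTraceLeft hρ)
  have hcp : IsCompletelyPositive (krausMap L ∘ₗ traceAdjoint (krausMap K)) := by
    rw [traceAdjoint_krausMap, krausMap_comp_krausMap]
    exact isCompletelyPositive_krausMap _
  have hdom := posSemidef_cbNorm_smul_one_kronecker_sub_ampliation hcp hω.posSemidef
  rw [partialTraceLeft_add_smul_one, partialTraceLeft_ampliation hA.trace_map, ampliation_comp,
    ampliation_traceAdjoint_krausMap, ampliation_krausMap L] at hdom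
  have hmain := relEntropy_krausMap_le_neg_entropy_sub
    (fun X => ampliation_krausMap K X ▸ trace_ampliation hA.trace_map X)
    (fun X => ampliation_krausMap L X ▸ trace_ampliation hB.trace_map X)
    hρ hω ((PosDef.one.kronecker hR).smul hc) hdom
  rwa [relEntropy, re_trace_mul_log_smul_one_kronecker _ hR hc, ← ampliation_krausMap,
    ← ampliation_krausMap, partialTraceLeft_ampliation hB.trace_map,
    trace_ampliation hB.trace_map] at hmain

open Filter Topology in
theorem entropy_uncertainty (hA : IsQuantumChannel ΦA) (hB : IsQuantumChannel ΦB)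
    {ρ : Matrix (M × C) (M × C) ℂ} (hρ : IsDensityOperator ρ) :
    vonNeumannEntropy ρ + vonNeumannEntropy (partialTraceLeft ρ)
        - Real.log (cbNorm (ΦB ∘ₗ traceAdjoint ΦA)).toReal
      ≤ vonNeumannEntropy (ampliation C ΦA ρ) + vonNeumannEntropy (ampliation C ΦB ρ) := by
  have : Nonempty M := (nonempty_prod.1 hρ.nonempty).1
  have hρC := posSemidef_partialTraceLeft hρ.posSemidef
  have hρA : (ampliation C ΦA ρ).PosSemidef := by
    obtain ⟨K, rfl⟩ := hA.completelyPositive.exists_eq_krausMap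
    exact ampliation_krausMap K ρ ▸ posSemidef_krausMap _ hρ.posSemidef
  have hscale : Tendsto (fun ε : ℝ => Fintype.card A * ε) (𝓝 0) (𝓝 0) := by
    simpa using (tendsto_id (x := 𝓝 (0 : ℝ))).const_mul (Fintype.card A : ℝ)
  have hlimC := (tendsto_re_trace_mul_log_add_smul_one hρC.isHermitian).comp hscale
  have hlimA := tendsto_re_trace_mul_log_add_smul_one hρA.isHermitian
  have hlim := le_of_tendsto_of_tendsto
    (((hlimC.const_add _).const_sub _).mono_left nhdsWithin_le_nhds)
    ((hlimA.const_sub _).mono_left nhdsWithin_le_nhds)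
    (eventually_mem_nhdsWithin.mono fun ε (hε : ε ∈ Set.Ioi 0) =>
      entropy_uncertainty_regularized hA hB hρ.posSemidef hε)
  rw [hρ.trace_eq_one, Complex.one_re, mul_one] at hlim
  linarith

end UncertaintyRelation

end ChannelUncertainty

theorem theorem4p1 {M A B C : Type*}
    [Fintype M] [DecidableEq M] [Fintype A] [DecidableEq A]
    [Fintype B] [DecidableEq B] [Fintype C] [DecidableEq C]
    (ΦA : Matrix M M ℂ →ₗ[ℂ] Matrix A A ℂ) (ΦB : Matrix M M ℂ →ₗ[ℂ] Matrix B B ℂ)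
    (hA : ChannelUncertainty.IsQuantumChannel ΦA)
    (hB : ChannelUncertainty.IsQuantumChannel ΦB)
    (ρ : Matrix (M × C) (M × C) ℂ) (hρ : ChannelUncertainty.IsDensityOperator ρ) :
    0 < ChannelUncertainty.cbNorm (ΦB ∘ₗ ChannelUncertainty.traceAdjoint ΦA) ∧
    ChannelUncertainty.cbNorm (ΦB ∘ₗ ChannelUncertainty.traceAdjoint ΦA) < ⊤ ∧
    ChannelUncertainty.condEntropy (ChannelUncertainty.ampliation C ΦA ρ)
        + ChannelUncertainty.condEntropy (ChannelUncertainty.ampliation C ΦB ρ)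
      ≥ ChannelUncertainty.condEntropy ρ
        + Real.log (1 /
          (ChannelUncertainty.cbNorm (ΦB ∘ₗ ChannelUncertainty.traceAdjoint ΦA)).toReal) := by
  have : Nonempty M := (nonempty_prod.1 hρ.nonempty).1
  refine ⟨ChannelUncertainty.cbNorm_pos (ChannelUncertainty.comp_traceAdjoint_ne_zero hA hB),
    ChannelUncertainty.cbNorm_lt_top _, ?_⟩
  have h := ChannelUncertainty.entropy_uncertainty hA hB hρ
  rw [ChannelUncertainty.condEntropy, ChannelUncertainty.condEntropy,
    ChannelUncertainty.condEntropy,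
    ChannelUncertainty.partialTraceLeft_ampliation hA.trace_map,
    ChannelUncertainty.partialTraceLeft_ampliation hB.trace_map, one_div, Real.log_inv]
  linarith
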